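/- For a compact set $K\subset\mathbb{C}^n$ and a polynomial $p\in\mathbb{C}[x_1,\dots,x_n]$ put $\|p\|_K=\sup_{x\in K}|p(x)|$, and let $\deg$ denote total degree. The compact set $K$ \emph{satisfies the division inequality} if there is an exponent $m>0$ such that for every polynomial $q\not\equiv 0$ on $K$ there is a constant $M>0$ (which may depend on $q$) with \[ \|p\|_K\le M(\deg p+\deg q)^{m\deg q}\,\|pq\|_K\qquad\text{for all polynomials } p\in\mathbb{C}[x_1,\dots,x_n]. \] (Here $0^0=1$.) The set $K$ is \emph{polynomially determining} if the only polynomial in $\mathbb{C}[x_1,\dots,x_n]$ vanishing on $K$ is the zero polynomial. Theorem. Let $k\ge 1$, let $\varsigma_0,\dots,\varsigma_{k-1}\in\mathbb{C}[z_1,\dots,z_N]$, and suppose that \[ s(z,y)=y^k+\sum_{j=0}^{k-1}\varsigma_j(z)\,y^j \] is irreducible in $\mathbb{C}[z_1,\dots,z_N,y]$. Let $V(s)=\{(z,y)\in\mathbb{C}^N\times\mathbb{C}: s(z,y)=0\}$. Let $K\subset\mathbb{C}^N$ be a compact set that is polynomially determining and satisfies the division inequality. Then the set \[ F=\{(z,y)\in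 V(s): z\in K\}\subset\mathbb{C}^{N+1} \] is compact and also satisfies the division inequality (with some exponent, not necessarily that of $K$). -/

import Mathlib

open MvPolynomial

noncomputable section

/-- The uniform norm `‖p‖_K = sup_{x ∈ K} |p(x)|` of a polynomial on a (compact) set `K ⊆ ℂⁿ`. -/
def polySupNorm {n : ℕ} (K : Set (Fin n → ℂ)) (p : MvPolynomial (Fin n) ℂ) : ℝ :=
  ⨆ x : K, ‖eval (x : Fin n → ℂ) p‖

/-- The division inequality with exponent `m` on a compact set `K ⊆ ℂⁿ`: for every polynomial
`q ≢ 0` on `K` there is `M > 0` such that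
`‖p‖_K ≤ M (deg p + deg q) ^ (m deg q) ‖p q‖_K` for all polynomials `p`. -/
def DivisionInequalityWith {n : ℕ} (K : Set (Fin n → ℂ)) (m : ℝ) : Prop :=
  ∀ q : MvPolynomial (Fin n) ℂ, (∃ x ∈ K, eval x q ≠ 0) →
    ∃ M : ℝ, 0 < M ∧ ∀ p : MvPolynomial (Fin n) ℂ,
      polySupNorm K p ≤
        M * ((p.totalDegree : ℝ) + (q.totalDegree : ℝ)) ^ (m * (q.totalDegree : ℝ))
          * polySupNorm K (p * q)

/-- `K` satisfies the division inequality, with some exponent `m > 0`. -/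
def SatisfiesDivisionInequality {n : ℕ} (K : Set (Fin n → ℂ)) : Prop :=
  ∃ m : ℝ, 0 < m ∧ DivisionInequalityWith K m

/-- `K` is determining for polynomials: a polynomial that vanishes on `K` is zero. -/
def PolynomiallyDetermining {n : ℕ} (K : Set (Fin n → ℂ)) : Prop :=
  ∀ p : MvPolynomial (Fin n) ℂ, (∀ x ∈ K, eval x p = 0) → p = 0

/-- The polynomial `s(z, y) = y ^ k + ∑_{j < k} ς_j(z) y ^ j` on `ℂᴺ⁺¹ = ℂᴺ × ℂ`, where
`y` is the last coordinate. -/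
def monicInLast {N : ℕ} (k : ℕ) (c : Fin k → MvPolynomial (Fin N) ℂ) :
    MvPolynomial (Fin (N + 1)) ℂ :=
  X (Fin.last N) ^ k + ∑ j : Fin k, rename Fin.castSucc (c j) * X (Fin.last N) ^ (j : ℕ)

/-- The zero set `V(s) ⊆ ℂⁿ`. -/
def zeroSet {n : ℕ} (s : MvPolynomial (Fin n) ℂ) : Set (Fin n → ℂ) :=
  {w | eval w s = 0}

/-- The lifted set `{(z, y) ∈ V(s) : z ∈ K}`. -/
def liftedSet {N : ℕ} (s : MvPolynomial (Fin (N + 1)) ℂ) (K : Set (Fin N → ℂ)) :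
    Set (Fin (N + 1) → ℂ) :=
  {w | w ∈ zeroSet s ∧ (fun i : Fin N => w i.castSucc) ∈ K}

end

/-! Multiplication by `p` on the free `ℂ[z]`-module `ℂ[z,y]/(s)` of rank `k` has a characteristic
polynomial whose roots over `z` are the values of `p` on the fibre of `F`
(`charpoly_mulMatrix_eval_eq_zero` and its converse). For `q`, the constant coefficient `r` is the
norm up to sign: nonzero because `s` is irreducible, and `|r| ≤ L|q|` on `F`. Hence `|p||r| ≤
L‖pq‖_F` on `F`, and Vieta bounds `a_i r^(k-i)` on `K`, where `a_i` are the coefficients for `p`.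

The division inequality on `K`, with divisor `r^(k-i)`, removes that factor; the degrees of `a_i`
and `r` are linear in those of `p` and `q`. The result is `‖a_i‖_K ≤ H^(k-i)` with `H` proportional
to `‖pq‖_F`, so the Cauchy root bound gives `‖p‖_F ≤ kH`. -/

/-! ### Degrees of the coefficients of a characteristic polynomial -/

/-- Every coefficient of `P` has total degree at most `D`. -/
def CoeffDegreeLE {σ R : Type*} [CommRing R] (D : ℕ) (P : Polynomial (MvPolynomial σ R)) : Prop :=
  ∀ i, (P.coeff i).totalDegree ≤ D

namespace CoeffDegreeLE

variable {σ R : Type*} [CommRing R] {D D' : ℕ} {P Q : Polynomial (MvPolynomial σ R)}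

theorem mul (hP : CoeffDegreeLE D P) (hQ : CoeffDegreeLE D' Q) : CoeffDegreeLE (D + D') (P * Q) := by
  intro i
  rw [Polynomial.coeff_mul]
  exact totalDegree_finsetSum_le fun x _ =>
    (totalDegree_mul _ _).trans (add_le_add (hP _) (hQ _))

theorem sum {ι : Type*} {s : Finset ι} {f : ι → Polynomial (MvPolynomial σ R)}
    (h : ∀ i ∈ s, CoeffDegreeLE D (f i)) : CoeffDegreeLE D (∑ i ∈ s, f i) := by
  intro i
  rw [Polynomial.finsetSum_coeff]
  exact totalDegree_finsetSum_le fun x hx => h x hx i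

theorem prod {ι : Type*} {s : Finset ι} {f : ι → Polynomial (MvPolynomial σ R)}
    (h : ∀ i ∈ s, CoeffDegreeLE D (f i)) : CoeffDegreeLE (s.card * D) (∏ i ∈ s, f i) := by
  classical
  induction s using Finset.induction_on with
  | empty =>
    intro i
    simp only [Finset.prod_empty, Polynomial.coeff_one]
    split_ifs <;> simp
  | insert a s ha ih =>
    rw [Finset.prod_insert ha, Finset.card_insert_of_notMem ha, add_mul, one_mul, add_comm]
    exact (h a (by simp)).mul (ih fun i hi => h i (by simp [hi]))

theorem neg (hP : CoeffDegreeLE D P) : CoeffDegreeLE D (-P) := by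
  intro i
  rw [Polynomial.coeff_neg, totalDegree_neg]
  exact hP i

theorem charpoly {n : Type*} [Fintype n] [DecidableEq n] {M : Matrix n n (MvPolynomial σ R)}
    (hM : ∀ i j, (M i j).totalDegree ≤ D) : CoeffDegreeLE (Fintype.card n * D) M.charpoly := by
  rw [Matrix.charpoly, Matrix.det_apply]
  refine sum fun τ _ => ?_
  have key : CoeffDegreeLE (Fintype.card n * D) (∏ i, M.charmatrix (τ i) i) := by
    refine prod fun i _ a => ?_
    rw [Matrix.charmatrix_apply, Polynomial.coeff_sub]
    refine (totalDegree_sub _ _).trans (max_le ?_ ?_)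
    · rw [Matrix.diagonal_apply]
      split_ifs
      · rw [Polynomial.coeff_X]
        split_ifs <;> simp
      · simp
    · rw [Polynomial.coeff_C]
      split_ifs
      · exact hM _ _
      · simp
  rcases Int.units_eq_one_or (Equiv.Perm.sign τ) with h | h
  · simpa [h] using key
  · simpa [h] using key.neg

end CoeffDegreeLE

/-! ### Degrees of matrix entries -/

section MatrixDegree

variable {σ τ R n : Type*} [CommRing R] [Fintype n]

theorem Matrix.totalDegree_mul_apply_le {M M' : Matrix n n (MvPolynomial σ R)} {D D' : ℕ}
    (h : ∀ i j, (M i j).totalDegree ≤ D) (h' : ∀ i j, (M' i j).totalDegree ≤ D') (i j : n) :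
    ((M * M') i j).totalDegree ≤ D + D' := by
  rw [Matrix.mul_apply]
  exact totalDegree_finsetSum_le fun x _ =>
    (totalDegree_mul _ _).trans (add_le_add (h _ _) (h' _ _))

theorem Matrix.totalDegree_pow_apply_le [DecidableEq n] {M : Matrix n n (MvPolynomial σ R)} {D : ℕ}
    (h : ∀ i j, (M i j).totalDegree ≤ D) (m : ℕ) :
    ∀ i j, ((M ^ m) i j).totalDegree ≤ m * D := by
  induction m with
  | zero =>
    intro i j
    rw [pow_zero, Matrix.one_apply]
    split_ifs <;> simp
  | succ m ih =>
    intro i j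
    rw [pow_succ, add_mul, one_mul]
    exact Matrix.totalDegree_mul_apply_le ih h i j

/-- If the images of the variables under an algebra homomorphism into matrices over a polynomial
ring have entries of degree at most `D`, then the image of `p` has entries of degree at most
`D * deg p`. -/
theorem AlgHom.totalDegree_matrix_apply_le [DecidableEq n]
    (f : MvPolynomial τ R →ₐ[R] Matrix n n (MvPolynomial σ R)) {D : ℕ}
    (h : ∀ t i j, (f (X t) i j).totalDegree ≤ D) (p : MvPolynomial τ R) (i j : n) :
    (f p i j).totalDegree ≤ D * p.totalDegree := by
  have hC : ∀ a i j, (f (C a) i j).totalDegree ≤ 0 := by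
    intro a i j
    rw [← algebraMap_eq, f.commutes, Matrix.algebraMap_matrix_apply]
    split_ifs
    · rw [algebraMap_eq]; simp
    · simp
  have hmon : ∀ (s : τ →₀ ℕ) (a : R) (i j : n),
      (f (monomial s a) i j).totalDegree ≤ s.degree * D := by
    intro s
    induction s using Finsupp.induction_linear with
    | zero =>
      intro a i j
      exact (hC a i j).trans (Nat.zero_le _)
    | add s t hs ht =>
      intro a i j
      have e : monomial (s + t) a = monomial s a * monomial t (1 : R) := by
        rw [monomial_mul, mul_one]
      rw [e, map_mul, map_add, add_mul]
      exact Matrix.totalDegree_mul_apply_le (hs a) (ht 1) i j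
    | single t m =>
      intro a i j
      rw [← C_mul_X_pow_eq_monomial, map_mul, map_pow, Finsupp.degree_single, ← zero_add (m * D)]
      exact Matrix.totalDegree_mul_apply_le (hC a) (Matrix.totalDegree_pow_apply_le (h t) m) i j
  conv_lhs => rw [p.as_sum, map_sum, Matrix.sum_apply]
  refine totalDegree_finsetSum_le fun s hs => (hmon s _ i j).trans ?_
  rw [mul_comm]
  exact Nat.mul_le_mul_left _ (le_totalDegree hs)

end MatrixDegree

/-! ### Polynomials in the last variable -/

section LastVariable

variable {N : ℕ}

/-- Polynomials in `N + 1` variables as polynomials in the last variable. -/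
noncomputable def lastVarEquiv (N : ℕ) :
    MvPolynomial (Fin (N + 1)) ℂ ≃ₐ[ℂ] Polynomial (MvPolynomial (Fin N) ℂ) :=
  (renameEquiv ℂ finSuccEquivLast).trans (optionEquivLeft ℂ (Fin N))

theorem lastVarEquiv_X_last : lastVarEquiv N (X (Fin.last N)) = Polynomial.X := by
  simp [lastVarEquiv]

theorem lastVarEquiv_X_castSucc (i : Fin N) :
    lastVarEquiv N (X i.castSucc) = Polynomial.C (X i) := by
  simp [lastVarEquiv]

theorem lastVarEquiv_C (a : ℂ) : lastVarEquiv N (C a) = Polynomial.C (C a) := by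
  simp [lastVarEquiv]

theorem lastVarEquiv_rename (p : MvPolynomial (Fin N) ℂ) :
    lastVarEquiv N (rename Fin.castSucc p) = Polynomial.C p := by
  induction p using MvPolynomial.induction_on with
  | C a => rw [rename_C, lastVarEquiv_C]
  | add p q hp hq => rw [map_add, map_add, hp, hq, map_add]
  | mul_X p i hp => rw [map_mul, map_mul, hp, rename_X, lastVarEquiv_X_castSucc, map_mul]

/-- Evaluation in terms of the polynomial in the last variable. -/
theorem eval₂_lastVarEquiv (w : Fin (N + 1) → ℂ) (p : MvPolynomial (Fin (N + 1)) ℂ) :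
    (lastVarEquiv N p).eval₂ (eval fun i : Fin N => w i.castSucc) (w (Fin.last N)) = eval w p := by
  induction p using MvPolynomial.induction_on with
  | C a => rw [lastVarEquiv_C, Polynomial.eval₂_C, eval_C, eval_C]
  | add p q hp hq => rw [map_add, Polynomial.eval₂_add, hp, hq, map_add]
  | mul_X p i hp =>
    have hX : (lastVarEquiv N (X i)).eval₂ (eval fun i : Fin N => w i.castSucc)
        (w (Fin.last N)) = w i := by
      induction i using Fin.lastCases with
      | last => rw [lastVarEquiv_X_last, Polynomial.eval₂_X]
      | cast i => rw [lastVarEquiv_X_castSucc, Polynomial.eval₂_C, eval_X]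
    rw [map_mul, Polynomial.eval₂_mul, hp, hX, map_mul, eval_X]

/-- The monic polynomial in the last variable with lower coefficients `c`. -/
noncomputable def monicPoly {k : ℕ} (c : Fin k → MvPolynomial (Fin N) ℂ) :
    Polynomial (MvPolynomial (Fin N) ℂ) :=
  Polynomial.X ^ k + ∑ j : Fin k, Polynomial.C (c j) * Polynomial.X ^ (j : ℕ)

theorem lastVarEquiv_monicInLast {k : ℕ} (c : Fin k → MvPolynomial (Fin N) ℂ) :
    lastVarEquiv N (monicInLast k c) = monicPoly c := by
  simp only [monicInLast, monicPoly, map_add, map_sum, map_mul, map_pow, lastVarEquiv_X_last,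
    lastVarEquiv_rename]

theorem monicPoly_monic {k : ℕ} (c : Fin k → MvPolynomial (Fin N) ℂ) : (monicPoly c).Monic :=
  Polynomial.monic_X_pow_add (Polynomial.degree_sum_fin_lt c)

theorem natDegree_monicPoly {k : ℕ} (c : Fin k → MvPolynomial (Fin N) ℂ) :
    (monicPoly c).natDegree = k :=
  Polynomial.natDegree_eq_of_degree_eq_some <| by
    rw [monicPoly, Polynomial.degree_add_eq_left_of_degree_lt] <;>
      rw [Polynomial.degree_X_pow]
    exact Polynomial.degree_sum_fin_lt c

end LastVariable

/-! ### Multiplication matrices and their characteristic polynomials -/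

section CharacteristicPolynomial

variable {N k : ℕ} (c : Fin k → MvPolynomial (Fin N) ℂ)

/-- The matrix of multiplication by `p` on `ℂ[z, y] / (s)`, a free `ℂ[z]`-module. -/
noncomputable def mulMatrix :
    MvPolynomial (Fin (N + 1)) ℂ →ₐ[ℂ]
      Matrix (Fin (AdjoinRoot.powerBasis' (monicPoly_monic c)).dim)
        (Fin (AdjoinRoot.powerBasis' (monicPoly_monic c)).dim) (MvPolynomial (Fin N) ℂ) :=
  (((Algebra.leftMulMatrix (AdjoinRoot.powerBasis' (monicPoly_monic c)).basis).comp
    (AdjoinRoot.mkₐ (monicPoly c))).restrictScalars ℂ).comp (lastVarEquiv N).toAlgHom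

theorem mulMatrix_apply (p : MvPolynomial (Fin (N + 1)) ℂ) :
    mulMatrix c p = Algebra.leftMulMatrix (AdjoinRoot.powerBasis' (monicPoly_monic c)).basis
      (AdjoinRoot.mk (monicPoly c) (lastVarEquiv N p)) := rfl

/-- Specialization at `z` of the multiplication matrix. -/
theorem map_leftMulMatrix_mk (z : Fin N → ℂ) (P : Polynomial (MvPolynomial (Fin N) ℂ)) :
    (Algebra.leftMulMatrix (AdjoinRoot.powerBasis' (monicPoly_monic c)).basis
      (AdjoinRoot.mk (monicPoly c) P)).map (eval z) =
    Polynomial.aeval ((Algebra.leftMulMatrix (AdjoinRoot.powerBasis' (monicPoly_monic c)).basis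
      (AdjoinRoot.root (monicPoly c))).map (eval z)) (P.map (eval z)) := by
  have hC : ∀ a, (Algebra.leftMulMatrix (AdjoinRoot.powerBasis' (monicPoly_monic c)).basis
      (AdjoinRoot.mk (monicPoly c) (Polynomial.C a))).map (eval z) =
      algebraMap ℂ _ (eval z a) := by
    intro a
    rw [AdjoinRoot.mk_C, ← AdjoinRoot.algebraMap_eq, AlgHom.commutes]
    ext i j
    rw [Matrix.map_apply, Matrix.algebraMap_matrix_apply, Matrix.algebraMap_matrix_apply]
    split_ifs <;> simp
  induction P using Polynomial.induction_on with
  | C a => rw [hC, Polynomial.map_C, Polynomial.aeval_C]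
  | add p q hp hq =>
    rw [map_add, map_add, Matrix.map_add _ (map_add _), hp, hq, Polynomial.map_add, map_add]
  | monomial n a ih =>
    rw [map_mul, map_mul, Matrix.map_mul, hC, map_pow, map_pow, AdjoinRoot.mk_X, Matrix.map_pow,
      Polynomial.map_mul, Polynomial.map_pow, Polynomial.map_X, Polynomial.map_C, map_mul,
      map_pow, Polynomial.aeval_X, Polynomial.aeval_C]

/-- Cayley–Hamilton in `ℂ[z,y]/(s)`, then evaluation at `w`, which factors through the quotient
because `s(w) = 0`. -/
theorem charpoly_mulMatrix_eval_eq_zero {w : Fin (N + 1) → ℂ}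
    (hw : w ∈ zeroSet (monicInLast k c)) (p : MvPolynomial (Fin (N + 1)) ℂ) :
    (mulMatrix c p).charpoly.eval₂ (eval fun i : Fin N => w i.castSucc) (eval w p) = 0 := by
  have hcay : Polynomial.aeval (AdjoinRoot.mk (monicPoly c) (lastVarEquiv N p))
      (mulMatrix c p).charpoly = 0 := by
    apply Algebra.leftMulMatrix_injective (AdjoinRoot.powerBasis' (monicPoly_monic c)).basis
    rw [map_zero, ← Polynomial.aeval_algHom_apply, ← mulMatrix_apply]
    exact Matrix.aeval_self_charpoly _
  have h0 : (monicPoly c).eval₂ (eval fun i : Fin N => w i.castSucc) (w (Fin.last N)) = 0 := by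
    rw [← lastVarEquiv_monicInLast, eval₂_lastVarEquiv]
    exact hw
  have := congrArg (AdjoinRoot.lift (eval fun i : Fin N => w i.castSucc) (w (Fin.last N)) h0) hcay
  rw [map_zero, Polynomial.aeval_def, Polynomial.hom_eval₂, AdjoinRoot.lift_mk,
    eval₂_lastVarEquiv] at this
  rw [← this]
  congr 1
  ext x <;> simp [AdjoinRoot.algebraMap_eq]

/-- Spectral mapping: with `T` the matrix of `y` specialized at `z`, the eigenvalues of `p(z,T)` are
the `p(z,y)` for `y` in the spectrum of `T`, and `s(z,T) = 0` forces `s(z,y) = 0`. -/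
theorem exists_mem_zeroSet_of_charpoly_mulMatrix_eval_eq_zero (hk : 1 ≤ k) {z : Fin N → ℂ} {t : ℂ}
    (p : MvPolynomial (Fin (N + 1)) ℂ) (ht : (mulMatrix c p).charpoly.eval₂ (eval z) t = 0) :
    ∃ w ∈ zeroSet (monicInLast k c), (fun i : Fin N => w i.castSucc) = z ∧ eval w p = t := by
  set B := (AdjoinRoot.powerBasis' (monicPoly_monic c)).basis with hB
  have hdim : (AdjoinRoot.powerBasis' (monicPoly_monic c)).dim = k := natDegree_monicPoly c
  have : Nonempty (Fin (AdjoinRoot.powerBasis' (monicPoly_monic c)).dim) := ⟨⟨0, by omega⟩⟩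
  set T := (Algebra.leftMulMatrix B (AdjoinRoot.root (monicPoly c))).map (eval z) with hT
  have hmem : t ∈ spectrum ℂ (Polynomial.aeval T ((lastVarEquiv N p).map (eval z))) := by
    apply Matrix.mem_spectrum_of_isRoot_charpoly
    rw [hT, ← map_leftMulMatrix_mk, ← mulMatrix_apply, Matrix.charpoly_map, Polynomial.IsRoot,
      Polynomial.eval_map]
    exact ht
  rw [spectrum.map_polynomial_aeval_of_nonempty _ _ (spectrum.nonempty_of_isAlgClosed_of_finiteDimensional ℂ T)] at hmem
  obtain ⟨y, hy, hyt⟩ := hmem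
  have hy0 : ((monicPoly c).map (eval z)).eval y = 0 := by
    have h0 : Polynomial.aeval T ((monicPoly c).map (eval z)) = 0 := by
      rw [hT, ← map_leftMulMatrix_mk, AdjoinRoot.mk_self, map_zero]
      ext; simp
    have := spectrum.subset_polynomial_aeval T ((monicPoly c).map (eval z)) ⟨y, hy, rfl⟩
    rw [h0, spectrum.zero_eq] at this
    exact this
  have hz : (fun i : Fin N => (Fin.snoc z y : Fin (N + 1) → ℂ) i.castSucc) = z := by
    ext i; simp
  refine ⟨Fin.snoc z y, ?_, hz, ?_⟩
  · rw [zeroSet, Set.mem_ofPred_eq, ← eval₂_lastVarEquiv, lastVarEquiv_monicInLast, hz,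
      Fin.snoc_last, ← Polynomial.eval_map]
    exact hy0
  · rw [← eval₂_lastVarEquiv, hz, Fin.snoc_last, ← Polynomial.eval_map]
    exact hyt

/-- Irreducible elements are prime here, so the quotient is a domain and the norm of the nonzero
class of `q` does not vanish. -/
theorem charpoly_mulMatrix_coeff_zero_ne_zero (hs : Irreducible (monicInLast k c))
    {w : Fin (N + 1) → ℂ} (hw : w ∈ zeroSet (monicInLast k c)) {q : MvPolynomial (Fin (N + 1)) ℂ}
    (hq : eval w q ≠ 0) : (mulMatrix c q).charpoly.coeff 0 ≠ 0 := by
  have hirr : Irreducible (monicPoly c) := by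
    rw [← lastVarEquiv_monicInLast]
    exact (MulEquiv.irreducible_iff (lastVarEquiv N)).2 hs
  have : IsDomain (AdjoinRoot (monicPoly c)) := AdjoinRoot.isDomain_of_prime hirr.prime
  have hne : AdjoinRoot.mk (monicPoly c) (lastVarEquiv N q) ≠ 0 := by
    rw [Ne, AdjoinRoot.mk_eq_zero]
    rintro ⟨g, hg⟩
    apply hq
    rw [← eval₂_lastVarEquiv, hg, Polynomial.eval₂_mul, ← lastVarEquiv_monicInLast,
      eval₂_lastVarEquiv, show eval w (monicInLast k c) = 0 from hw, zero_mul]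
  have hnorm := (Algebra.norm_ne_zero_iff_of_basis
    (AdjoinRoot.powerBasis' (monicPoly_monic c)).basis).2 hne
  rw [Algebra.norm_eq_matrix_det (AdjoinRoot.powerBasis' (monicPoly_monic c)).basis,
    ← mulMatrix_apply, Matrix.det_eq_sign_charpoly_coeff] at hnorm
  exact right_ne_zero_of_mul hnorm

theorem exists_totalDegree_charpoly_mulMatrix_coeff_le :
    ∃ E : ℕ, 1 ≤ E ∧ ∀ p i, ((mulMatrix c p).charpoly.coeff i).totalDegree ≤ E * p.totalDegree := by
  let D := Finset.univ.sup fun t => Finset.univ.sup fun i => Finset.univ.sup fun j =>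
    (mulMatrix c (X t) i j).totalDegree
  have hD : ∀ t i j, (mulMatrix c (X t) i j).totalDegree ≤ D := fun t i j =>
    ((Finset.le_sup (f := fun j => (mulMatrix c (X t) i j).totalDegree) (Finset.mem_univ j)).trans
      (Finset.le_sup (f := fun i => Finset.univ.sup fun j =>
        (mulMatrix c (X t) i j).totalDegree) (Finset.mem_univ i))).trans
      (Finset.le_sup (f := fun t => Finset.univ.sup fun i => Finset.univ.sup fun j =>
        (mulMatrix c (X t) i j).totalDegree) (Finset.mem_univ t))
  -- The `+ 1` only secures `1 ≤ E`.
  refine ⟨k * D + 1, by omega, fun p i => ?_⟩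
  have h := CoeffDegreeLE.charpoly ((mulMatrix c).totalDegree_matrix_apply_le hD p) i
  have hdim : (AdjoinRoot.powerBasis' (monicPoly_monic c)).dim = k := natDegree_monicPoly c
  rw [Fintype.card_fin] at h
  refine h.trans ?_
  rw [hdim, ← mul_assoc]
  exact Nat.mul_le_mul_right _ (Nat.le_succ _)

theorem natDegree_charpoly_mulMatrix (p : MvPolynomial (Fin (N + 1)) ℂ) :
    (mulMatrix c p).charpoly.natDegree = k := by
  rw [Matrix.charpoly_natDegree_eq_dim, Fintype.card_fin]
  exact natDegree_monicPoly c

end CharacteristicPolynomial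

/-! ### Sup norms and a root bound -/

section SupNorm

variable {n : ℕ} {K : Set (Fin n → ℂ)}

theorem polySupNorm_nonneg (K : Set (Fin n → ℂ)) (p : MvPolynomial (Fin n) ℂ) :
    0 ≤ polySupNorm K p :=
  Real.iSup_nonneg fun _ => norm_nonneg _

theorem norm_eval_le_polySupNorm (hK : IsCompact K) (p : MvPolynomial (Fin n) ℂ)
    {x : Fin n → ℂ} (hx : x ∈ K) : ‖eval x p‖ ≤ polySupNorm K p := by
  obtain ⟨B, hB⟩ := hK.exists_bound_of_continuousOn (MvPolynomial.continuous_eval p).continuousOn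
  exact le_ciSup (f := fun x : K => ‖eval (x : Fin n → ℂ) p‖)
    ⟨B, by rintro _ ⟨y, rfl⟩; exact hB y y.2⟩ ⟨x, hx⟩

theorem polySupNorm_le {B : ℝ} (hB : 0 ≤ B) {p : MvPolynomial (Fin n) ℂ}
    (h : ∀ x ∈ K, ‖eval x p‖ ≤ B) : polySupNorm K p ≤ B :=
  Real.iSup_le (fun x => h x x.2) hB

end SupNorm

/-- A Cauchy-type bound for the roots of a monic polynomial. -/
theorem Polynomial.Monic.norm_root_le {P : Polynomial ℂ} (hP : P.Monic) {H : ℝ} (hH : 0 ≤ H)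
    (hcoeff : ∀ i < P.natDegree, ‖P.coeff i‖ ≤ H ^ (P.natDegree - i)) {t : ℂ}
    (ht : P.eval t = 0) : ‖t‖ ≤ P.natDegree * H := by
  set k := P.natDegree with hk
  rcases Nat.eq_zero_or_pos k with h0 | hpos
  · rw [hP.natDegree_eq_zero.1 (hk ▸ h0)] at ht
    simp at ht
  by_contra! hlt
  have hHt : H ≤ ‖t‖ := by
    have : (1 : ℝ) ≤ k := by exact_mod_cast hpos
    nlinarith
  have ht0 : 0 < ‖t‖ := lt_of_le_of_lt (by positivity) hlt
  have hsum : t ^ k = -∑ i ∈ Finset.range k, P.coeff i * t ^ i := by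
    rw [Polynomial.eval_eq_sum_range, Finset.sum_range_succ, ← hk, hk, hP.coeff_natDegree, one_mul,
      ← hk] at ht
    exact eq_neg_of_add_eq_zero_right ht
  -- Since `H ≤ ‖t‖`, all but one factor `H` in each term can be traded for `‖t‖`.
  have hle : ‖t‖ ^ k ≤ k * (H * ‖t‖ ^ (k - 1)) := by
    rw [← norm_pow, hsum, norm_neg]
    refine (norm_sum_le _ _).trans ?_
    refine (Finset.sum_le_card_nsmul _ _ (H * ‖t‖ ^ (k - 1)) fun i hi => ?_).trans_eq
      (by rw [Finset.card_range, nsmul_eq_mul])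
    rw [Finset.mem_range] at hi
    rw [norm_mul, norm_pow]
    calc ‖P.coeff i‖ * ‖t‖ ^ i ≤ H ^ (k - i) * ‖t‖ ^ i := by gcongr; exact hcoeff i hi
      _ = H * (H ^ (k - 1 - i) * ‖t‖ ^ i) := by
        rw [← mul_assoc, ← pow_succ', show k - 1 - i + 1 = k - i by omega]
      _ ≤ H * (‖t‖ ^ (k - 1 - i) * ‖t‖ ^ i) := by gcongr
      _ = H * ‖t‖ ^ (k - 1) := by rw [← pow_add, show k - 1 - i + i = k - 1 by omega]
  have : ‖t‖ ^ k = ‖t‖ * ‖t‖ ^ (k - 1) := by rw [← pow_succ', Nat.sub_add_cancel hpos]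
  rw [this, ← mul_assoc] at hle
  exact absurd (le_of_mul_le_mul_right hle (by positivity)) (not_le.2 hlt)

/-! ### Compactness and the division inequality on the lifted set -/

section LiftedSet

variable {N k : ℕ} {c : Fin k → MvPolynomial (Fin N) ℂ} {K : Set (Fin N → ℂ)}

theorem isCompact_liftedSet (hK : IsCompact K) : IsCompact (liftedSet (monicInLast k c) K) := by
  have hproj : Continuous fun (w : Fin (N + 1) → ℂ) (i : Fin N) => w i.castSucc := by fun_prop
  obtain ⟨R, hR⟩ := hK.isBounded.exists_norm_le
  choose D hD using fun j : Fin k =>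
    hK.exists_bound_of_continuousOn (MvPolynomial.continuous_eval (c j)).continuousOn
  set H : ℝ := 1 + ∑ j, |D j| with hH
  have hH1 : 1 ≤ H := le_add_of_nonneg_right (Finset.sum_nonneg fun j _ => abs_nonneg _)
  have hDH : ∀ j, D j ≤ H := fun j =>
    (le_abs_self _).trans <| (Finset.single_le_sum (f := fun j => |D j|)
      (fun i _ => abs_nonneg _) (Finset.mem_univ j)).trans (by linarith)
  have hcl : IsClosed (liftedSet (monicInLast k c) K) :=
    (isClosed_eq (MvPolynomial.continuous_eval _) continuous_const).inter
      (hK.isClosed.preimage hproj)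
  refine Metric.isCompact_of_isClosed_isBounded hcl
    (isBounded_iff_forall_norm_le.2 ⟨max R (k * H), fun w hw => ?_⟩)
  have hle : 0 ≤ max R (k * H) := le_max_of_le_right (by positivity)
  refine (pi_norm_le_iff_of_nonneg hle).2 fun i => ?_
  induction i using Fin.lastCases with
  | cast i =>
    exact (norm_le_pi_norm (fun i : Fin N => w i.castSucc) i).trans
      ((hR _ hw.2).trans (le_max_left _ _))
  | last =>
    refine le_trans ?_ (le_max_right _ _)
    set f := eval fun i : Fin N => w i.castSucc with hf
    have hmon : ((monicPoly c).map f).Monic := (monicPoly_monic c).map f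
    have hdeg : ((monicPoly c).map f).natDegree = k := by
      rw [(monicPoly_monic c).natDegree_map, natDegree_monicPoly]
    have := hmon.norm_root_le (H := H) (by linarith) (t := w (Fin.last N)) ?_ ?_
    · rwa [hdeg] at this
    · rw [hdeg]
      intro i hi
      have : (monicPoly c).coeff i = c ⟨i, hi⟩ := by
        rw [monicPoly, Polynomial.coeff_add, Polynomial.coeff_X_pow, if_neg hi.ne, zero_add,
          Polynomial.finsetSum_coeff, Finset.sum_eq_single ⟨i, hi⟩]
        · simp
        · intro j _ hj
          rw [Polynomial.coeff_C_mul_X_pow, if_neg]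
          rintro rfl
          exact hj rfl
        · simp
      rw [Polynomial.coeff_map, this]
      exact ((hD _ _ hw.2).trans (hDH _)).trans (le_self_pow₀ hH1 (by omega))
    · rw [Polynomial.eval_map, ← lastVarEquiv_monicInLast, eval₂_lastVarEquiv]
      exact hw.1

/-- The norm of `q` is, on the lifted set, dominated by `q`. -/
theorem exists_norm_charpoly_coeff_zero_le (hF : IsCompact (liftedSet (monicInLast k c) K))
    (q : MvPolynomial (Fin (N + 1)) ℂ) :
    ∃ B : ℝ, 0 < B ∧ ∀ w ∈ liftedSet (monicInLast k c) K,
      ‖eval (fun i : Fin N => w i.castSucc) ((mulMatrix c q).charpoly.coeff 0)‖ ≤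
        B * ‖eval w q‖ := by
  set P := (mulMatrix c q).charpoly with hP
  have hcont : Continuous fun w : Fin (N + 1) → ℂ =>
      P.divX.eval₂ (eval fun i : Fin N => w i.castSucc) (eval w q) := by
    simp_rw [Polynomial.eval₂_eq_sum_range]
    refine continuous_finsetSum _ fun i _ => Continuous.mul ?_ ?_
    · exact (MvPolynomial.continuous_eval _).comp (by fun_prop)
    · exact (MvPolynomial.continuous_eval _).pow _
  obtain ⟨B, hB⟩ := hF.exists_bound_of_continuousOn hcont.continuousOn
  refine ⟨max B 1, by positivity, fun w hw => ?_⟩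
  -- Writing `P = P.divX * X + r`, the root `q(w)` gives `r = -q(w) · P.divX(q(w))`, whose second
  -- factor is bounded on the compact `F`.
  have h0 := charpoly_mulMatrix_eval_eq_zero c hw.1 q
  rw [← hP, ← Polynomial.divX_mul_X_add P, Polynomial.eval₂_add, Polynomial.eval₂_mul,
    Polynomial.eval₂_X, Polynomial.eval₂_C] at h0
  rw [eq_neg_of_add_eq_zero_right h0, norm_neg, norm_mul]
  gcongr
  exact (hB w hw).trans (le_max_left _ _)

/-- If `‖p(w)‖ * ‖r(z)‖ ≤ B` on the lifted set, then the coefficients of the characteristic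
polynomial of `p`, multiplied by powers of `r`, are bounded on `K`. -/
theorem polySupNorm_charpoly_coeff_mul_pow_le (hk : 1 ≤ k) {p : MvPolynomial (Fin (N + 1)) ℂ}
    {r : MvPolynomial (Fin N) ℂ} {B : ℝ} (hB : 0 ≤ B)
    (h : ∀ w ∈ liftedSet (monicInLast k c) K,
      ‖eval w p‖ * ‖eval (fun i : Fin N => w i.castSucc) r‖ ≤ B) {i : ℕ} (hi : i < k) :
    polySupNorm K ((mulMatrix c p).charpoly.coeff i * r ^ (k - i)) ≤ k.choose i * B ^ (k - i) := by
  refine polySupNorm_le (by positivity) fun z hz => ?_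
  rw [map_mul, map_pow, norm_mul, norm_pow]
  -- Where `r` vanishes the roots are uncontrolled, but `k - i ≥ 1` makes the product zero.
  by_cases hr : eval z r = 0
  · rw [hr, norm_zero, zero_pow (by omega), mul_zero]
    positivity
  have hr' : 0 < ‖eval z r‖ := norm_pos_iff.2 hr
  have hmon : ((mulMatrix c p).charpoly.map (eval z)).Monic := (Matrix.charpoly_monic _).map _
  have hco := Polynomial.coeff_le_of_roots_le (p := (mulMatrix c p).charpoly.map (eval z))
    (f := RingHom.id ℂ) (B := B / ‖eval z r‖) i hmon (IsAlgClosed.splits _) (fun t ht => by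
      rw [Polynomial.map_id, Polynomial.mem_roots hmon.ne_zero, Polynomial.IsRoot,
        Polynomial.eval_map] at ht
      obtain ⟨w, hw, rfl, rfl⟩ :=
        exists_mem_zeroSet_of_charpoly_mulMatrix_eval_eq_zero c hk p ht
      rw [le_div_iff₀ hr']
      exact h w ⟨hw, hz⟩)
  rw [Polynomial.map_id, Polynomial.coeff_map, (Matrix.charpoly_monic _).natDegree_map,
    natDegree_charpoly_mulMatrix, div_pow] at hco
  calc _ ≤ B ^ (k - i) / ‖eval z r‖ ^ (k - i) * k.choose i * ‖eval z r‖ ^ (k - i) := by gcongr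
    _ = _ := by field_simp

theorem satisfiesDivisionInequality_liftedSet (hk : 1 ≤ k) (hs : Irreducible (monicInLast k c))
    (hK : IsCompact K) (hdet : PolynomiallyDetermining K) (hdiv : SatisfiesDivisionInequality K) :
    SatisfiesDivisionInequality (liftedSet (monicInLast k c) K) := by
  obtain ⟨m, hm, hdiv⟩ := hdiv
  obtain ⟨E, hE, hdeg⟩ := exists_totalDegree_charpoly_mulMatrix_coeff_le c
  have hF : IsCompact (liftedSet (monicInLast k c) K) := isCompact_liftedSet hK
  set F := liftedSet (monicInLast k c) K with hFdef
  have hkR : (1 : ℝ) ≤ k := by exact_mod_cast hk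
  have hER : (1 : ℝ) ≤ E := by exact_mod_cast hE
  refine ⟨m * E, by positivity, fun q ⟨w₀, hw₀, hq₀⟩ => ?_⟩
  -- Constant `q` is treated apart: the exponent is then 0, while `1 ≤ X` below needs `deg q ≥ 1`.
  rcases Nat.eq_zero_or_pos q.totalDegree with hq | hq
  · have hqC := totalDegree_eq_zero_iff_eq_C.1 hq
    set a := coeff 0 q
    have ha : a ≠ 0 := by
      rintro h
      rw [hqC, h, C_0, map_zero] at hq₀
      exact hq₀ rfl
    refine ⟨‖a‖⁻¹, by positivity, fun p => ?_⟩
    rw [hq, Nat.cast_zero, mul_zero, Real.rpow_zero, mul_one]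
    refine polySupNorm_le (by have := polySupNorm_nonneg F (p * q); positivity) fun w hw => ?_
    have h := norm_eval_le_polySupNorm hF (p * q) hw
    rw [map_mul, norm_mul, hqC, eval_C] at h
    rw [hqC, le_inv_mul_iff₀ (norm_pos_iff.2 ha), mul_comm]
    exact h
  set r := (mulMatrix c q).charpoly.coeff 0 with hr
  have hr0 : r ≠ 0 := charpoly_mulMatrix_coeff_zero_ne_zero c hs hw₀.1 hq₀
  obtain ⟨L, hL, hLr⟩ := exists_norm_charpoly_coeff_zero_le hF q
  have hpow : ∀ j : ℕ, ∃ x ∈ K, eval x (r ^ j) ≠ 0 := fun j => by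
    by_contra! h
    exact pow_ne_zero j hr0 (hdet _ h)
  choose M hM hMp using fun j : ℕ => hdiv (r ^ j) (hpow j)
  -- One constant for the finitely many divisors `r^(k-i)`; being at least 1, it is below its own
  -- powers.
  set Q : ℝ := 1 + ∑ i ∈ Finset.range k, M (k - i) * k.choose i with hQ
  have hterm : ∀ i ∈ Finset.range k, 0 ≤ M (k - i) * k.choose i := fun i _ =>
    mul_nonneg (hM _).le (Nat.cast_nonneg _)
  have hQ1 : 1 ≤ Q := le_add_of_nonneg_right (Finset.sum_nonneg hterm)
  have hqR : (1 : ℝ) ≤ q.totalDegree := by exact_mod_cast hq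
  set e : ℝ := m * E * q.totalDegree with he
  have he0 : 0 ≤ e := by positivity
  refine ⟨k * (Q * ((k : ℝ) * E) ^ e * L), by positivity, fun p => ?_⟩
  have hpq := polySupNorm_nonneg F (p * q)
  set B := L * polySupNorm F (p * q) with hB
  have hB0 : 0 ≤ B := by positivity
  have hpr : ∀ w ∈ F, ‖eval w p‖ * ‖eval (fun i : Fin N => w i.castSucc) r‖ ≤ B := fun w hw => by
    have h := norm_eval_le_polySupNorm hF (p * q) hw
    rw [map_mul, norm_mul] at h
    calc _ ≤ ‖eval w p‖ * (L * ‖eval w q‖) := by gcongr; exact hLr w hw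
      _ = L * (‖eval w p‖ * ‖eval w q‖) := by ring
      _ ≤ B := by rw [hB]; gcongr
  set X : ℝ := (k : ℝ) * E * (p.totalDegree + q.totalDegree) with hX
  have hp0 : (0 : ℝ) ≤ p.totalDegree := Nat.cast_nonneg _
  have hkE : (1 : ℝ) ≤ k * E := one_le_mul_of_one_le_of_one_le hkR hER
  have hX1 : 1 ≤ X := one_le_mul_of_one_le_of_one_le hkE (by linarith)
  -- The exponent of `X` for the divisor `r^(k-i)` is at most `(k-i)e`, so the whole bound is a
  -- `(k-i)`-th power.
  set H : ℝ := Q * X ^ e * B with hH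
  have hH0 : 0 ≤ H := by positivity
  have hcoeff : ∀ i < k, polySupNorm K ((mulMatrix c p).charpoly.coeff i) ≤ H ^ (k - i) := by
    intro i hi
    have hj : k - i ≠ 0 := by omega
    have hrdeg : (r ^ (k - i)).totalDegree ≤ (k - i) * (E * q.totalDegree) :=
      (totalDegree_pow _ _).trans (Nat.mul_le_mul_left _ (hdeg q 0))
    have hbase : (((mulMatrix c p).charpoly.coeff i).totalDegree : ℝ) +
        (r ^ (k - i)).totalDegree ≤ X := by
      have h1 : ((mulMatrix c p).charpoly.coeff i).totalDegree ≤ k * (E * p.totalDegree) :=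
        (hdeg p i).trans (Nat.le_mul_of_pos_left _ hk)
      have h2 : (r ^ (k - i)).totalDegree ≤ k * (E * q.totalDegree) :=
        hrdeg.trans (Nat.mul_le_mul_right _ (Nat.sub_le _ _))
      have h3 : (((mulMatrix c p).charpoly.coeff i).totalDegree : ℝ) ≤ k * (E * p.totalDegree) := by
        exact_mod_cast h1
      have h4 : ((r ^ (k - i)).totalDegree : ℝ) ≤ k * (E * q.totalDegree) := by exact_mod_cast h2
      rw [hX]
      linarith
    have hexp : m * ((r ^ (k - i)).totalDegree : ℝ) ≤ e * (k - i : ℕ) := by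
      have : ((r ^ (k - i)).totalDegree : ℝ) ≤ (k - i : ℕ) * (E * q.totalDegree) := by
        exact_mod_cast hrdeg
      calc _ ≤ m * ((k - i : ℕ) * (E * q.totalDegree)) := by gcongr
        _ = _ := by rw [he]; ring
    have hrpow : ((((mulMatrix c p).charpoly.coeff i).totalDegree : ℝ) +
        (r ^ (k - i)).totalDegree) ^ (m * ((r ^ (k - i)).totalDegree : ℝ)) ≤
        (X ^ e) ^ (k - i) := by
      rw [← Real.rpow_mul_natCast (by linarith)]
      exact (Real.rpow_le_rpow (by positivity) hbase (by positivity)).trans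
        (Real.rpow_le_rpow_of_exponent_le hX1 hexp)
    have hMQ : M (k - i) * k.choose i ≤ Q ^ (k - i) :=
      ((Finset.single_le_sum hterm (Finset.mem_range.2 hi)).trans (by linarith)).trans
        (le_self_pow₀ hQ1 hj)
    have hMpos := hM (k - i)
    calc polySupNorm K ((mulMatrix c p).charpoly.coeff i)
        ≤ M (k - i) * ((((mulMatrix c p).charpoly.coeff i).totalDegree : ℝ) +
          (r ^ (k - i)).totalDegree) ^ (m * ((r ^ (k - i)).totalDegree : ℝ)) *
          polySupNorm K ((mulMatrix c p).charpoly.coeff i * r ^ (k - i)) := hMp _ _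
      _ ≤ M (k - i) * (X ^ e) ^ (k - i) * (k.choose i * B ^ (k - i)) := by
        gcongr
        · exact polySupNorm_nonneg _ _
        · exact polySupNorm_charpoly_coeff_mul_pow_le hk hB0 hpr hi
      _ = M (k - i) * k.choose i * ((X ^ e) ^ (k - i) * B ^ (k - i)) := by ring
      _ ≤ Q ^ (k - i) * ((X ^ e) ^ (k - i) * B ^ (k - i)) := by gcongr
      _ = H ^ (k - i) := by rw [hH, mul_pow _ B, mul_pow Q, mul_assoc]
  have hmain : polySupNorm F p ≤ k * H := by
    refine polySupNorm_le (by positivity) fun w hw => ?_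
    have hmon : ((mulMatrix c p).charpoly.map (eval fun i : Fin N => w i.castSucc)).Monic :=
      (Matrix.charpoly_monic _).map _
    have hnat : ((mulMatrix c p).charpoly.map
        (eval fun i : Fin N => w i.castSucc)).natDegree = k := by
      rw [(Matrix.charpoly_monic _).natDegree_map, natDegree_charpoly_mulMatrix]
    have := hmon.norm_root_le hH0 (t := eval w p) ?_ ?_
    · rwa [hnat] at this
    · rw [hnat]
      intro i hi
      rw [Polynomial.coeff_map]
      exact (norm_eval_le_polySupNorm hK _ hw.2).trans (hcoeff i hi)
    · rw [Polynomial.eval_map]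
      exact charpoly_mulMatrix_eval_eq_zero c hw.1 p
  refine hmain.trans_eq ?_
  -- The factor `(kE)^e` depends on `q` but not on `p`, so it joins the constant.
  rw [hH, hX, Real.mul_rpow (by positivity) (by positivity), hB]
  ring

end LiftedSet

theorem mainTheorem4 (N k : ℕ) (hk : 1 ≤ k) (c : Fin k → MvPolynomial (Fin N) ℂ)
    (hs : Irreducible (monicInLast k c))
    (K : Set (Fin N → ℂ)) (hK : IsCompact K)
    (hdet : PolynomiallyDetermining K) (hdiv : SatisfiesDivisionInequality K) :
    IsCompact (liftedSet (monicInLast k c) K) ∧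
      SatisfiesDivisionInequality (liftedSet (monicInLast k c) K) :=
  ⟨isCompact_liftedSet hK, satisfiesDivisionInequality_liftedSet hk hs hK hdet hdiv⟩
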